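/- Let $d\ge 1$ and $0\le n\le m\le N$ be integers and let $\kappa\in\mathbb R^{d+1}$ with $\kappa_i>-1$ for all $i$. Write $|\kappa|=\kappa_1+\dots+\kappa_{d+1}$, $(a)_k=a(a+1)\cdots(a+k-1)$, and, for $\alpha\in\mathbb N_0^{d+1}$, $|\alpha|=\sum_i\alpha_i$, $\alpha!=\prod_i\alpha_i!$, $(\kappa+\mathbf 1)_\alpha=\prod_i(\kappa_i+1)_{\alpha_i}$. Let $\Pi_k^d$ be the space of real polynomials of total degree at most $k$ in $x_1,\dots,x_d$ (with $\Pi_{-1}^d=\{0\}$); a polynomial is evaluated at a point $x=(x_1,\dots,x_{d+1})\in\mathbb N_0^{d+1}$ with $|x|=N$ through its first $d$ coordinates, so that $x_{d+1}=N-x_1-\dots-x_d$. On $\Pi_N^d$ consider the inner product $$\langle f,g\rangle=\frac{N!}{(|\kappa|+d+1)_N}\sum_{x\in\mathbb N_0^{d+1},\,|x|=N}f(x)g(x)\,\frac{(\kappa+\mathbf 1)_x}{x!},$$ and let $\mathcal V_n^d=\{p\in\Pi_n^d:\langle p,q\rangle=0\text{ for all }q\in\Pi_{n-1}^d\}$.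 For $\alpha\in\mathbb N_0^{d+1}$ with $|\alpha|=m$ let $\mathrm m_\alpha(x)=(-1)^{|\alpha|}\prod_{i=1}^{d+1}(-x_i)_{\alpha_i}$ and $$\mathsf Q_{\alpha,n}=\frac1{(\kappa+\mathbf 1)_\alpha}\,\mathrm{proj}_{\mathcal V_n^d}\,\mathrm m_\alpha ,$$ where $\mathrm{proj}_{\mathcal V_n^d}$ is the orthogonal projection of $\Pi_N^d$ onto $\mathcal V_n^d$. Put $$\mathsf D_n(m,N)=\frac{(-N)_n\,m!\,(|\kappa|+d+1)_N\,(|\kappa|+d+1)_{m+n}}{(-m)_n\,[(-N)_m]^2\,(|\kappa|+d+1)_{N+n}} .$$ Then every $f\in\mathcal V_n^d$ satisfies $$f=\mathsf D_n(m,N)\sum_{|\alpha|=m}\frac{(\kappa+\mathbf 1)_\alpha}{\alpha!}\,\langle f,\mathsf Q_{\alpha,n}\rangle\,\mathsf Q_{\alpha,n}.$$ Furthermore, $\{\mathsf Q_{\alpha,n}:|\alpha|=m\}\subset\mathcal V_n^d$ is a tight frame of $\mathcal V_n^d$ in the sense that for all $f\in\mathcal V_n^d$ $$\langle f,f\rangle=\mathsf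 D_n(m,N)\sum_{|\alpha|=m}\frac{(\kappa+\mathbf 1)_\alpha}{\alpha!}\,\langle f,\mathsf Q_{\alpha,n}\rangle^2;$$ that is, the rescaled polynomials $v_\alpha=\sqrt{\mathsf D_n(m,N)(\kappa+\mathbf 1)_\alpha/\alpha!}\;\mathsf Q_{\alpha,n}$ lie in $\mathcal V_n^d$ and satisfy $\langle f,f\rangle=\sum_{|\alpha|=m}\langle f,v_\alpha\rangle^2$ for all $f\in\mathcal V_n^d$. -/

import Mathlib

open Finset MvPolynomial

/-- The Pochhammer symbol `(a)_k = a (a + 1) ⋯ (a + k - 1)`. -/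
noncomputable def poch (a : ℝ) (k : ℕ) : ℝ := (ascPochhammer ℝ k).eval a

/-- The homogeneous grid: all `α ∈ ℕ₀^{d+1}` with `|α| = α₁ + ⋯ + α_{d+1} = N`. -/
def homGrid (d N : ℕ) : Finset (Fin (d + 1) → ℕ) := Finset.piAntidiag univ N

/-- `λ_κ = |κ| + d + 1`. -/
noncomputable def hahnLam {d : ℕ} (κ : Fin (d + 1) → ℝ) : ℝ := (∑ i, κ i) + d + 1

/-- `(κ + 1)_α = ∏ᵢ (κᵢ + 1)_{αᵢ}`. -/
noncomputable def pochShift {d : ℕ} (κ : Fin (d + 1) → ℝ) (α : Fin (d + 1) → ℕ) : ℝ :=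
  ∏ i, poch (κ i + 1) (α i)

/-- The Hahn weight `H_κ(α) = (κ + 1)_α / α!`. -/
noncomputable def hahnWeight {d : ℕ} (κ : Fin (d + 1) → ℝ) (α : Fin (d + 1) → ℕ) : ℝ :=
  pochShift κ α / ∏ i, ((α i).factorial : ℝ)

/-- The value of a polynomial in the `d` variables `x₁, …, x_d` at a point of the homogeneous grid,
whose last coordinate `x_{d+1} = N - x₁ - ⋯ - x_d` is determined by the others. -/
noncomputable def evalGrid {d : ℕ} (x : Fin (d + 1) → ℕ) (p : MvPolynomial (Fin d) ℝ) : ℝ :=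
  MvPolynomial.eval (fun i : Fin d => (x i.castSucc : ℝ)) p

/-- The bilinear form
`⟨f, g⟩ = N! / (λ_κ)_N * ∑_{|x| = N} f(x) g(x) H_κ(x)`
on polynomials in `d` variables. For `κᵢ > -1` it is an inner product on the space of polynomials
of total degree at most `N`; see `hahnForm_symm` and `hahnForm_pos`. -/
noncomputable def hahnForm {d : ℕ} (κ : Fin (d + 1) → ℝ) (N : ℕ) :
    LinearMap.BilinForm ℝ (MvPolynomial (Fin d) ℝ) :=
  LinearMap.mk₂ ℝ
    (fun f g => (N.factorial : ℝ) / poch (hahnLam κ) N *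
      ∑ x ∈ homGrid d N, evalGrid x f * evalGrid x g * hahnWeight κ x)
    (fun f f' g => by simp only [evalGrid, map_add, add_mul, sum_add_distrib, mul_add])
    (fun c f g => by
      simp only [evalGrid, smul_eval, smul_eq_mul, mul_sum]
      exact sum_congr rfl fun x _ => by ring)
    (fun f g g' => by simp only [evalGrid, map_add, add_mul, sum_add_distrib, mul_add])
    (fun c f g => by
      simp only [evalGrid, smul_eval, smul_eq_mul, mul_sum]
      exact sum_congr rfl fun x _ => by ring)

/-- The space `𝒱_n^d` of orthogonal polynomials of degree `n`: polynomials of total degree at most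
`n` that are orthogonal to all polynomials of total degree at most `n - 1`
(for `n = 0` the latter condition is void). -/
noncomputable def hahnSpace {d : ℕ} (κ : Fin (d + 1) → ℝ) (N n : ℕ) :
    Submodule ℝ (MvPolynomial (Fin d) ℝ) where
  carrier := {p | p.totalDegree ≤ n ∧
    ∀ q : MvPolynomial (Fin d) ℝ, q.totalDegree < n → hahnForm κ N p q = 0}
  add_mem' := fun {a b} ha hb =>
    ⟨(totalDegree_add a b).trans (max_le ha.1 hb.1), fun q hq => by
      rw [map_add, LinearMap.add_apply, ha.2 q hq, hb.2 q hq, add_zero]⟩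
  zero_mem' := ⟨by simp, fun q _ => by simp⟩
  smul_mem' := fun c a ha =>
    ⟨(totalDegree_smul_le c a).trans ha.1, fun q hq => by
      rw [map_smul, LinearMap.smul_apply, ha.2 q hq, smul_zero]⟩

/-- The homogeneous coordinates `x₁, …, x_d, x_{d+1} = N - x₁ - ⋯ - x_d` as polynomials in
`x₁, …, x_d`. -/
noncomputable def homCoord (d N : ℕ) (i : Fin (d + 1)) : MvPolynomial (Fin d) ℝ :=
  Fin.lastCases (motive := fun _ => MvPolynomial (Fin d) ℝ)
    (C (N : ℝ) - ∑ j : Fin d, X j) (fun j => X j) i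

/-- The monic polynomial `m_α(x) = (-1)^{|α|} (-x)_α = (-1)^{|α|} ∏ᵢ (-xᵢ)_{αᵢ}`, with `x` the
homogeneous coordinates. -/
noncomputable def hahnMonic {d : ℕ} (N : ℕ) (α : Fin (d + 1) → ℕ) : MvPolynomial (Fin d) ℝ :=
  (-1) ^ (∑ i, α i) * ∏ i, Polynomial.aeval (-homCoord d N i) (ascPochhammer ℝ (α i))

theorem hahnForm_apply {d : ℕ} (κ : Fin (d + 1) → ℝ) (N : ℕ) (f g : MvPolynomial (Fin d) ℝ) :
    hahnForm κ N f g = (N.factorial : ℝ) / poch (hahnLam κ) N *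
      ∑ x ∈ homGrid d N, evalGrid x f * evalGrid x g * hahnWeight κ x := rfl

theorem hahnForm_symm {d : ℕ} (κ : Fin (d + 1) → ℝ) (N : ℕ) (f g : MvPolynomial (Fin d) ℝ) :
    hahnForm κ N f g = hahnForm κ N g f := by
  simp only [hahnForm_apply, mul_comm (evalGrid _ f)]

theorem hahnWeight_pos {d : ℕ} {κ : Fin (d + 1) → ℝ} (hκ : ∀ i, -1 < κ i)
    (α : Fin (d + 1) → ℕ) : 0 < hahnWeight κ α := by
  refine div_pos (prod_pos fun i _ => ascPochhammer_pos _ _ (by linarith [hκ i])) ?_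
  exact prod_pos fun i _ => by positivity

theorem hahnLam_pos {d : ℕ} {κ : Fin (d + 1) → ℝ} (hκ : ∀ i, -1 < κ i) : 0 < hahnLam κ := by
  have h : hahnLam κ = ∑ i, (κ i + 1) := by
    simp [hahnLam, sum_add_distrib, add_assoc]
  rw [h]
  exact sum_pos (fun i _ => by linarith [hκ i]) univ_nonempty

/-- A polynomial of total degree at most `N` is determined by its values on the grid. -/
theorem exists_evalGrid_ne_zero {d N : ℕ} {p : MvPolynomial (Fin d) ℝ} (hp : p ≠ 0)
    (hN : p.totalDegree ≤ N) : ∃ x ∈ homGrid d N, evalGrid x p ≠ 0 := by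
  obtain ⟨t, ht, hmax⟩ := p.support.exists_max_image (fun t => t.degree)
    (support_nonempty.2 hp)
  have hdeg : p.totalDegree = t.degree := by
    refine le_antisymm (Finset.sup_le fun s hs => hmax s hs) (le_totalDegree ht)
  obtain ⟨s, hs, hne⟩ := combinatorial_nullstellensatz_exists_eval_nonzero p t
    (mem_support_iff.1 ht) hdeg (fun i => (range (t i + 1)).image (fun k : ℕ => (k : ℝ)))
    (fun i => by rw [card_image_of_injective _ Nat.cast_injective]; simp)
  have hs' : ∀ i, ∃ k : ℕ, k ≤ t i ∧ (k : ℝ) = s i := fun i => by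
    obtain ⟨k, hk, h⟩ := mem_image.1 (hs i)
    exact ⟨k, by simpa [Nat.lt_succ_iff] using hk, h⟩
  choose y hy hys using hs'
  have hsum : ∑ i, y i ≤ N := by
    calc ∑ i, y i ≤ ∑ i, t i := sum_le_sum fun i _ => hy i
      _ = t.degree := (Finsupp.degree_eq_sum t).symm
      _ ≤ N := hdeg ▸ hN
  refine ⟨Fin.snoc (α := fun _ => ℕ) y (N - ∑ i, y i), ?_, ?_⟩
  · simp only [homGrid, mem_piAntidiag, mem_univ, implies_true, and_true]
    rw [Fin.sum_univ_castSucc]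
    simp only [Fin.snoc_castSucc, Fin.snoc_last]
    omega
  · simpa [evalGrid, hys] using hne

theorem hahnForm_pos {d N : ℕ} {κ : Fin (d + 1) → ℝ} (hκ : ∀ i, -1 < κ i)
    {p : MvPolynomial (Fin d) ℝ} (hp : p ≠ 0) (hN : p.totalDegree ≤ N) :
    0 < hahnForm κ N p p := by
  rw [hahnForm_apply]
  refine mul_pos (div_pos (by positivity) (ascPochhammer_pos _ _ (hahnLam_pos hκ))) ?_
  obtain ⟨x, hx, hne⟩ := exists_evalGrid_ne_zero hp hN
  exact sum_pos' (fun y _ => mul_nonneg (mul_self_nonneg _) (hahnWeight_pos hκ y).le)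
    ⟨x, hx, mul_pos (mul_self_pos.2 hne) (hahnWeight_pos hκ x)⟩

instance hahnSpace_finiteDimensional {d : ℕ} (κ : Fin (d + 1) → ℝ) (N n : ℕ) :
    FiniteDimensional ℝ (hahnSpace κ N n) :=
  Submodule.finiteDimensional_of_le (S₂ := restrictTotalDegree (Fin d) ℝ n)
    fun p hp => (mem_restrictTotalDegree _ _ p).2 hp.1

/-- For `n ≤ N` every polynomial is uniquely the sum of an element of `𝒱_n^d` and of a polynomial
orthogonal to `𝒱_n^d`. -/
theorem isCompl_hahnSpace {d N n : ℕ} {κ : Fin (d + 1) → ℝ} (hκ : ∀ i, -1 < κ i) (hn : n ≤ N) :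
    IsCompl (hahnSpace κ N n) ((hahnForm κ N).orthogonal (hahnSpace κ N n)) := by
  have key : ∀ p ∈ hahnSpace κ N n, hahnForm κ N p p = 0 → p = 0 := fun p hp h => by
    by_contra hne
    exact (hahnForm_pos hκ hne (hp.1.trans hn)).ne' h
  constructor
  · rw [Submodule.disjoint_def]
    intro p hp hp'
    exact key p hp (hp' p hp)
  · rw [codisjoint_iff, eq_top_iff]
    intro p _
    let L : hahnSpace κ N n →ₗ[ℝ] Module.Dual ℝ (hahnSpace κ N n) :=
      (hahnForm κ N).restrict (hahnSpace κ N n)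
    have hinj : Function.Injective L := by
      rw [← LinearMap.ker_eq_bot, LinearMap.ker_eq_bot']
      intro u hu
      exact Subtype.ext (key u u.2 (LinearMap.congr_fun hu u))
    have hsurj : Function.Surjective L :=
      (LinearMap.injective_iff_surjective_of_finrank_eq_finrank
        Subspace.dual_finrank_eq.symm).1 hinj
    obtain ⟨u, hu⟩ := hsurj ((hahnForm κ N p).comp (hahnSpace κ N n).subtype)
    refine Submodule.mem_sup.2 ⟨u, u.2, p - u, ?_, by abel⟩
    intro v hv
    have h := LinearMap.congr_fun hu ⟨v, hv⟩
    change hahnForm κ N u v = hahnForm κ N p v at h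
    change hahnForm κ N v (p - u) = 0
    rw [hahnForm_symm, map_sub, LinearMap.sub_apply, h, sub_self]

/-- The orthogonal projection onto `𝒱_n^d`, `n ≤ N`: the linear projection along the orthogonal
complement of `𝒱_n^d`. (It is defined on all polynomials; on those of total degree at most `N`,
where the form is an inner product, it is the orthogonal projection in the usual sense.) -/
noncomputable def hahnProj {d N n : ℕ} {κ : Fin (d + 1) → ℝ} (hκ : ∀ i, -1 < κ i) (hn : n ≤ N) :
    MvPolynomial (Fin d) ℝ →ₗ[ℝ] MvPolynomial (Fin d) ℝ :=
  (hahnSpace κ N n).projection ((hahnForm κ N).orthogonal (hahnSpace κ N n))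
    (isCompl_hahnSpace hκ hn)

/-- The projected monic Hahn polynomial
`Q_{α,n}(· ; κ, N) = (1 / (κ + 1)_α) proj_{𝒱_n^d} m_α`. -/
noncomputable def hahnQ {d N n : ℕ} {κ : Fin (d + 1) → ℝ} (hκ : ∀ i, -1 < κ i) (hn : n ≤ N)
    (α : Fin (d + 1) → ℕ) : MvPolynomial (Fin d) ℝ :=
  (1 / pochShift κ α) • hahnProj hκ hn (hahnMonic N α)

/-- The constant
`D_n(m,N) = (-N)_n m! (λ_κ)_N (λ_κ)_{m+n} / ((-m)_n [(-N)_m]² (λ_κ)_{N+n})`. -/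
noncomputable def hahnD {d : ℕ} (κ : Fin (d + 1) → ℝ) (n m N : ℕ) : ℝ :=
  (poch (-(N : ℝ)) n * (m.factorial : ℝ) * poch (hahnLam κ) N * poch (hahnLam κ) (m + n)) /
    (poch (-(m : ℝ)) n * (poch (-(N : ℝ)) m) ^ 2 * poch (hahnLam κ) (N + n))

/-- A finite family `(v_k)_{k ∈ s}` of elements of `V` is a (Parseval) tight frame of `V`, with
respect to the inner product on `V` given by the bilinear form `B`, if
`(u, u) = ∑_k (u, v_k)²` for all `u ∈ V`. -/
def IsTightFrame {E ι : Type*} [AddCommGroup E] [Module ℝ E] (B : LinearMap.BilinForm ℝ E)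
    (V : Submodule ℝ E) (s : Finset ι) (v : ι → E) : Prop :=
  (∀ k ∈ s, v k ∈ V) ∧ ∀ u ∈ V, B u u = ∑ k ∈ s, (B u (v k)) ^ 2

/-! The proof rests on two operators between functions on the grids |x| = N and |α| = m: U =
`urnAverage κ (N - m)` and S = `samplingSum d m`, adjoint for the Hahn weights
(`sum_hahnWeight_mul_urnAverage`). For f in 𝒱_n, ⟨f, Q_α⟩ is c · Uf(α) with c = N!/(λ_κ)_N
(`hahnForm_hahnQ`), so the frame sum for f and g is c times the form applied to f and SUg.

U is diagonal on rising products and S on falling ones, with eigenvalues depending only on the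
degree; hence SU is a scalar on degree n modulo lower degree. As SU is also self-adjoint, it is
exactly that scalar on 𝒱_n (`samplingSum_urnAverage_of_mem_hahnSpace`). The constant D_n(m,N)
inverts c times this scalar (`hahnD_mul_hahnEigenvalue`). This gives the polarised norm identity,
and the expansion follows by positive definiteness. -/

theorem mem_homGrid {d N : ℕ} {x : Fin (d + 1) → ℕ} : x ∈ homGrid d N ↔ ∑ i, x i = N := by
  simp [homGrid]

/-! ### Pochhammer symbols and Vandermonde sums -/

/-- The multivariate Chu–Vandermonde identity for binomial coefficients with real upper entries. -/
theorem sum_piAntidiag_prod_choose {ι : Type*} [DecidableEq ι] (s : Finset ι) (a : ι → ℝ) (n : ℕ) :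
    ∑ γ ∈ piAntidiag s n, ∏ i ∈ s, Ring.choose (a i) (γ i) = Ring.choose (∑ i ∈ s, a i) n := by
  induction s using Finset.cons_induction generalizing n with
  | empty =>
    rw [piAntidiag_empty, sum_empty, Ring.choose_zero_ite]
    split_ifs <;> simp
  | cons i s hi ih =>
    rw [piAntidiag_cons, sum_disjiUnion, sum_cons, Ring.add_choose_eq n (Commute.all _ _)]
    refine sum_congr rfl fun p _ => ?_
    rw [sum_map, ← ih, mul_sum]
    refine sum_congr rfl fun γ hγ => ?_
    have h0 : γ i = 0 := by
      by_contra h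
      exact hi ((mem_piAntidiag.1 hγ).2 i h)
    rw [prod_cons]
    congr 1
    · simp [h0]
    · refine prod_congr rfl fun j hj => ?_
      have : j ≠ i := fun h => hi (h ▸ hj)
      simp [this]

theorem poch_div_factorial (a : ℝ) (k : ℕ) :
    poch a k / (k.factorial : ℝ) = (-1) ^ k * Ring.choose (-a) k := by
  have h := Ring.factorial_nsmul_multichoose_eq_ascPochhammer a k
  rw [Polynomial.ascPochhammer_smeval_eq_eval, nsmul_eq_mul] at h
  rw [Ring.choose_neg', poch, ← h, mul_div_cancel_left₀ _ (by positivity)]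
  rw [Int.negOnePow_def]
  simp [Units.smul_def, ← mul_assoc, ← mul_pow]

theorem poch_add (a : ℝ) (k l : ℕ) : poch a (k + l) = poch a k * poch (a + k) l := by
  rw [poch, ← ascPochhammer_mul]
  simp [poch]

theorem poch_pos {a : ℝ} (ha : 0 < a) (k : ℕ) : 0 < poch a k :=
  ascPochhammer_pos _ _ ha

theorem poch_eq_prod (a : ℝ) (k : ℕ) : poch a k = ∏ j ∈ range k, (a + j) := by
  induction k with
  | zero => simp [poch]
  | succ k ih => rw [poch_add, ih, prod_range_succ]; simp [poch]

theorem neg_one_pow_mul_poch_neg (k l : ℕ) :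
    (-1 : ℝ) ^ l * poch (-(k : ℝ)) l = k.descFactorial l := by
  rw [poch, ascPochhammer_eval_neg_eq_descPochhammer, descPochhammer_eval_eq_descFactorial,
    ← mul_assoc, ← mul_pow]
  simp

theorem poch_neg (k l : ℕ) : poch (-(k : ℝ)) l = (-1) ^ l * k.descFactorial l := by
  rw [← neg_one_pow_mul_poch_neg, ← mul_assoc, ← mul_pow]
  simp

theorem hahnWeight_eq_prod {d : ℕ} (κ : Fin (d + 1) → ℝ) (α : Fin (d + 1) → ℕ) :
    hahnWeight κ α = ∏ i, poch (κ i + 1) (α i) / ((α i).factorial : ℝ) := by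
  rw [hahnWeight, pochShift, prod_div_distrib]

/-- Each weight is, up to the common sign (-1)^M, a product of binomials with upper entries -(κᵢ +
1), which add up to -λ_κ; Chu–Vandermonde sums them. No sign condition on κ enters. -/
theorem sum_hahnWeight {d : ℕ} (κ : Fin (d + 1) → ℝ) (M : ℕ) :
    ∑ y ∈ homGrid d M, hahnWeight κ y = poch (hahnLam κ) M / (M.factorial : ℝ) := by
  have h : -hahnLam κ = ∑ i, -(κ i + 1) := by
    simp [hahnLam, sum_add_distrib]; ring
  rw [poch_div_factorial, h, ← sum_piAntidiag_prod_choose, mul_sum]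
  refine sum_congr rfl fun y hy => ?_
  rw [← mem_homGrid.1 hy, hahnWeight_eq_prod, ← prod_pow_eq_pow_sum, ← prod_mul_distrib]
  exact prod_congr rfl fun i _ => poch_div_factorial _ _

theorem sum_prod_natChoose {d : ℕ} (x : Fin (d + 1) → ℕ) (M : ℕ) :
    ∑ y ∈ homGrid d M, ∏ i, ((x i).choose (y i) : ℝ) = ((∑ i, x i).choose M : ℝ) := by
  have h := sum_piAntidiag_prod_choose univ (fun i => (x i : ℝ)) M
  rw [← Nat.cast_sum] at h
  simp only [Ring.choose_natCast] at h
  exact h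

/-- Translating a sum over the grid by `β`. -/
theorem sum_homGrid_add {d M k N : ℕ} {β : Fin (d + 1) → ℕ} (hβ : ∑ i, β i = k) (hN : k + M = N)
    (F : (Fin (d + 1) → ℕ) → ℝ) (hF : ∀ x, ¬ β ≤ x → F x = 0) :
    ∑ x ∈ homGrid d N, F x = ∑ y ∈ homGrid d M, F (β + y) := by
  symm
  refine sum_of_injOn (fun y => β + y) (fun _ _ _ _ h => add_left_cancel h) ?_ ?_ fun _ _ => rfl
  · intro y hy
    have := mem_homGrid.1 hy
    simp [mem_homGrid, sum_add_distrib, hβ, this, hN]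
  · intro x hx hx'
    refine hF x fun hle => hx' ⟨x - β, ?_, add_tsub_cancel_of_le hle⟩
    have h1 := mem_homGrid.1 hx
    have h2 : ∑ i, β i + ∑ i, (x - β) i = ∑ i, x i := by
      rw [← sum_add_distrib]
      exact sum_congr rfl fun i _ => congrFun (add_tsub_cancel_of_le hle) i
    simp only [mem_coe, mem_homGrid]
    omega

/-! ### Degree filtration and factorial-type products -/

/-- The polynomials of total degree less than `k`. -/
noncomputable def lowDegree (d k : ℕ) : Submodule ℝ (MvPolynomial (Fin d) ℝ) :=
  restrictSupport ℝ {s | s.degree < k}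

theorem mem_lowDegree_succ {d k : ℕ} {p : MvPolynomial (Fin d) ℝ} :
    p ∈ lowDegree d (k + 1) ↔ p.totalDegree ≤ k := by
  simp only [lowDegree, mem_restrictSupport_iff, Nat.lt_succ_iff, totalDegree, Finset.sup_le_iff]
  rfl

/-- The strict degree bound lets index 0 play the role of Π_{-1} = {0}. -/
theorem lowDegree_zero (d : ℕ) : lowDegree d 0 = ⊥ := by
  rw [eq_bot_iff]
  intro p hp
  rw [lowDegree, mem_restrictSupport_iff] at hp
  simpa using hp

theorem lowDegree_mono {d k l : ℕ} (h : k ≤ l) : lowDegree d k ≤ lowDegree d l :=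
  restrictSupport_mono _ fun _ hs => lt_of_lt_of_le hs h

theorem eq_zero_or_totalDegree_lt {d k : ℕ} {p : MvPolynomial (Fin d) ℝ}
    (hp : p ∈ lowDegree d k) : p = 0 ∨ p.totalDegree < k := by
  cases k with
  | zero => left; simpa [lowDegree_zero] using hp
  | succ k => right; exact Nat.lt_succ_of_le (mem_lowDegree_succ.1 hp)

/-- The products `∏ᵢ (xᵢ + cᵢ₀) ⋯ (xᵢ + c_{i,βᵢ-1})`. -/
noncomputable def shiftedProd {d : ℕ} (c : Fin d → ℕ → ℝ) (β : Fin d → ℕ) :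
    MvPolynomial (Fin d) ℝ :=
  ∏ i, ∏ j ∈ range (β i), (X i + C (c i j))

theorem X_mul_shiftedProd {d : ℕ} (c : Fin d → ℕ → ℝ) (β : Fin d → ℕ) (i : Fin d) :
    X i * shiftedProd c β =
      shiftedProd c (β + Pi.single i 1) - c i (β i) • shiftedProd c β := by
  have h : shiftedProd c (β + Pi.single i 1) = (X i + C (c i (β i))) * shiftedProd c β := by
    simp only [shiftedProd]
    rw [← mul_prod_erase univ _ (mem_univ i), ← mul_prod_erase univ _ (mem_univ i), ← mul_assoc]
    congr 1
    · simp [prod_range_succ, mul_comm]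
    · refine prod_congr rfl fun j hj => ?_
      simp [Pi.single_eq_of_ne (ne_of_mem_erase hj)]
  rw [h, smul_eq_C_mul]
  ring

theorem totalDegree_shiftedProd_le {d : ℕ} (c : Fin d → ℕ → ℝ) (β : Fin d → ℕ) :
    (shiftedProd c β).totalDegree ≤ ∑ i, β i := by
  refine (totalDegree_finsetProd _ _).trans (sum_le_sum fun i _ => ?_)
  refine (totalDegree_finsetProd _ _).trans ?_
  refine (sum_le_sum fun j _ => show _ ≤ 1 from ?_).trans (by simp)
  refine (totalDegree_add _ _).trans ?_
  simp

/-- A nonconstant monomial is Xᵢ times one of smaller degree, and Xᵢ times a product is the next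
product minus a multiple of the same one. Leaving `c` arbitrary covers rising and falling products
at once. -/
theorem lowDegree_le_span {d : ℕ} (c : Fin d → ℕ → ℝ) (k : ℕ) :
    lowDegree d k ≤ Submodule.span ℝ (shiftedProd c '' {β | ∑ i, β i < k}) := by
  induction k with
  | zero => simp [lowDegree_zero]
  | succ k ih =>
    have hmul : ∀ i, ∀ p ∈ Submodule.span ℝ (shiftedProd c '' {β | ∑ i, β i < k}),
        X i * p ∈ Submodule.span ℝ (shiftedProd c '' {β | ∑ i, β i < k + 1}) := by
      intro i p hp
      induction hp using Submodule.span_induction with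
      | mem p hp =>
        obtain ⟨β, hβ, rfl⟩ := hp
        rw [X_mul_shiftedProd]
        refine sub_mem (Submodule.subset_span ⟨_, ?_, rfl⟩)
          (Submodule.smul_mem _ _ (Submodule.subset_span ⟨_, ?_, rfl⟩))
        · simpa [sum_add_distrib] using hβ
        · exact Nat.lt_succ_of_lt hβ
      | zero => simp
      | add p q _ _ hp hq => rw [mul_add]; exact add_mem hp hq
      | smul a p _ hp => rw [mul_smul_comm]; exact Submodule.smul_mem _ _ hp
    rw [lowDegree, restrictSupport_eq_span, Submodule.span_le]
    rintro _ ⟨s, hs, rfl⟩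
    change s.degree < k + 1 at hs
    by_cases h0 : s = 0
    · refine Submodule.subset_span ⟨0, by simp, ?_⟩
      simp [h0, shiftedProd]
    · obtain ⟨i, hi⟩ := Finsupp.ne_iff.1 h0
      obtain ⟨t, rfl⟩ : ∃ t, s = Finsupp.single i 1 + t :=
        le_iff_exists_add.1 (Finsupp.single_le_iff.2 (Nat.one_le_iff_ne_zero.2 hi))
      have ht : t.degree < k := by
        rw [map_add, Finsupp.degree_single] at hs
        omega
      change monomial (Finsupp.single i 1 + t) (1 : ℝ) ∈ _
      rw [monomial_single_add, pow_one]
      refine hmul i _ (ih ?_)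
      rw [lowDegree, monomial_mem_restrictSupport]
      exact Or.inl ht

theorem shiftedProd_mem_lowDegree {d k : ℕ} (c : Fin d → ℕ → ℝ) {β : Fin d → ℕ}
    (h : ∑ i, β i < k) : shiftedProd c β ∈ lowDegree d k :=
  lowDegree_mono h (mem_lowDegree_succ.2 (totalDegree_shiftedProd_le c β))

/-- An operator on functions on the grid which is diagonal on the products `shiftedProd c β`, with
eigenvalues depending only on the degree, acts as a scalar modulo polynomials of lower degree. -/
theorem exists_lower_of_diagonal {d n M N : ℕ} (c : Fin d → ℕ → ℝ) (e : ℕ → ℝ)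
    (T : ((Fin (d + 1) → ℕ) → ℝ) →ₗ[ℝ] ((Fin (d + 1) → ℕ) → ℝ))
    (hT : ∀ β : Fin d → ℕ, ∑ i, β i ≤ M → ∀ x ∈ homGrid d N,
      T (fun y => evalGrid y (shiftedProd c β)) x = e (∑ i, β i) * evalGrid x (shiftedProd c β))
    (hn : n ≤ M) {p : MvPolynomial (Fin d) ℝ} (hp : p ∈ lowDegree d (n + 1)) :
    ∃ r ∈ lowDegree d n, ∀ x ∈ homGrid d N,
      T (fun y => evalGrid y p) x = evalGrid x (e n • p + r) := by
  replace hp := lowDegree_le_span c _ hp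
  induction hp using Submodule.span_induction with
  | mem p hp =>
    obtain ⟨β, hβ, rfl⟩ := hp
    -- The remainder is the eigenvalue discrepancy: it is zero for |β| = n, and otherwise the
    -- product itself has lower degree.
    refine ⟨(e (∑ i, β i) - e n) • shiftedProd c β, ?_, fun x hx => ?_⟩
    · rcases (Nat.lt_succ_iff.1 hβ).lt_or_eq with h | h
      · exact Submodule.smul_mem _ _ (shiftedProd_mem_lowDegree c h)
      · simp [h]
    · rw [hT β ((Nat.lt_succ_iff.1 hβ).trans hn) x hx, ← add_smul]
      simp [evalGrid]
  | zero => exact ⟨0, zero_mem _, fun x _ => by simp [evalGrid, ← Pi.zero_def]⟩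
  | add p q _ _ hp hq =>
    obtain ⟨r, hr, h⟩ := hp
    obtain ⟨s, hs, h'⟩ := hq
    refine ⟨r + s, add_mem hr hs, fun x hx => ?_⟩
    have : (fun y => evalGrid y (p + q)) = (fun y => evalGrid y p) + fun y => evalGrid y q := by
      ext y; simp [evalGrid]
    rw [this, map_add, Pi.add_apply, h x hx, h' x hx]
    simp [evalGrid]
    ring
  | smul a p _ hp =>
    obtain ⟨r, hr, h⟩ := hp
    refine ⟨a • r, Submodule.smul_mem _ _ hr, fun x hx => ?_⟩
    have : (fun y => evalGrid y (a • p)) = a • fun y => evalGrid y p := by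
      ext y; simp [evalGrid]
    rw [this, map_smul, Pi.smul_apply, h x hx]
    simp [evalGrid]
    ring

/-! ### The two adjoint operators -/

/-- The Pólya-urn average
`f ↦ (α ↦ ∑_{|y| = M} f(α + y) (κ + α + 1)_y / y!)`. -/
noncomputable def urnAverage {d : ℕ} (κ : Fin (d + 1) → ℝ) (M : ℕ) :
    ((Fin (d + 1) → ℕ) → ℝ) →ₗ[ℝ] ((Fin (d + 1) → ℕ) → ℝ) where
  toFun f α := ∑ y ∈ homGrid d M, f (α + y) * hahnWeight (fun i => κ i + α i) y
  map_add' f g := by ext α; simp [add_mul, sum_add_distrib]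
  map_smul' c f := by ext α; simp [mul_sum, mul_assoc]

/-- The sampling operator `h ↦ (x ↦ ∑_{|α| = m} ∏ᵢ (xᵢ choose αᵢ) h(α))`. -/
noncomputable def samplingSum (d m : ℕ) :
    ((Fin (d + 1) → ℕ) → ℝ) →ₗ[ℝ] ((Fin (d + 1) → ℕ) → ℝ) where
  toFun h x := ∑ α ∈ homGrid d m, h α * ∏ i, ((x i).choose (α i) : ℝ)
  map_add' f g := by ext α; simp [add_mul, sum_add_distrib]
  map_smul' c f := by ext α; simp [mul_sum, mul_assoc]

theorem urnAverage_apply {d : ℕ} (κ : Fin (d + 1) → ℝ) (M : ℕ) (f : (Fin (d + 1) → ℕ) → ℝ)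
    (α : Fin (d + 1) → ℕ) : urnAverage κ M f α =
      ∑ y ∈ homGrid d M, f (α + y) * hahnWeight (fun i => κ i + α i) y := rfl

theorem samplingSum_apply {d m : ℕ} (h : (Fin (d + 1) → ℕ) → ℝ) (x : Fin (d + 1) → ℕ) :
    samplingSum d m h x = ∑ α ∈ homGrid d m, h α * ∏ i, ((x i).choose (α i) : ℝ) := rfl

theorem samplingSum_congr {d m : ℕ} {f g : (Fin (d + 1) → ℕ) → ℝ}
    (h : ∀ x ∈ homGrid d m, f x = g x) : samplingSum d m f = samplingSum d m g := by
  ext x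
  exact sum_congr rfl fun α hα => by rw [h α hα]

theorem pochShift_add {d : ℕ} (κ : Fin (d + 1) → ℝ) (α y : Fin (d + 1) → ℕ) :
    pochShift κ (α + y) = pochShift κ α * pochShift (fun i => κ i + α i) y := by
  simp only [pochShift, ← prod_mul_distrib, Pi.add_apply, poch_add]
  refine prod_congr rfl fun i _ => ?_
  rw [add_right_comm]

theorem factorial_prod_ne_zero {d : ℕ} (α : Fin (d + 1) → ℕ) :
    (∏ i, ((α i).factorial : ℝ)) ≠ 0 :=
  prod_ne_zero_iff.2 fun i _ => by positivity

/-- Pointwise form of the adjointness: (κ+1)_{α+y} splits as (κ+1)_α (κ+α+1)_y, and the binomials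
account for the factorials. -/
theorem hahnWeight_mul_hahnWeight {d : ℕ} (κ : Fin (d + 1) → ℝ) (α y : Fin (d + 1) → ℕ) :
    hahnWeight κ α * hahnWeight (fun i => κ i + α i) y =
      hahnWeight κ (α + y) * ∏ i, (((α + y) i).choose (α i) : ℝ) := by
  have h : (∏ i, (((α + y) i).choose (α i) : ℝ)) * (∏ i, ((α i).factorial : ℝ)) *
      (∏ i, ((y i).factorial : ℝ)) = ∏ i, (((α + y) i).factorial : ℝ) := by
    simp only [← prod_mul_distrib]
    refine prod_congr rfl fun i _ => ?_
    rw [Pi.add_apply, add_comm, ← Nat.add_choose_mul_factorial_mul_factorial (y i) (α i)]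
    push_cast
    ring
  simp only [hahnWeight, pochShift_add]
  have h1 := factorial_prod_ne_zero α
  have h2 := factorial_prod_ne_zero y
  have h3 := factorial_prod_ne_zero (α + y)
  rw [div_mul_div_comm, div_mul_eq_mul_div, div_eq_div_iff (mul_ne_zero h1 h2) h3, ← h]
  ring

/-- `urnAverage` and `samplingSum` are adjoint with respect to the Hahn weights. -/
theorem sum_hahnWeight_mul_urnAverage {d m M N : ℕ} (κ : Fin (d + 1) → ℝ) (hN : m + M = N)
    (f h : (Fin (d + 1) → ℕ) → ℝ) :
    ∑ α ∈ homGrid d m, hahnWeight κ α * (h α * urnAverage κ M f α) =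
      ∑ x ∈ homGrid d N, f x * samplingSum d m h x * hahnWeight κ x := by
  simp only [samplingSum_apply, mul_sum, sum_mul]
  rw [sum_comm]
  refine sum_congr rfl fun α hα => ?_
  -- For fixed α the binomials vanish unless α ≤ x, so x runs over α + y.
  rw [sum_homGrid_add (mem_homGrid.1 hα) hN, urnAverage_apply, mul_sum, mul_sum]
  · refine sum_congr rfl fun y _ => ?_
    linear_combination f (α + y) * h α * hahnWeight_mul_hahnWeight κ α y
  · intro x hx
    obtain ⟨i, hi⟩ := not_forall.1 hx
    rw [prod_eq_zero (mem_univ i)]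
    · simp
    · rw [Nat.choose_eq_zero_of_lt (not_le.1 hi), Nat.cast_zero]

/-! ### Diagonal action on rising and falling products -/

theorem sum_snoc_zero {d : ℕ} (β : Fin d → ℕ) :
    ∑ i, (Fin.snoc (α := fun _ => ℕ) β 0 : Fin (d + 1) → ℕ) i = ∑ i, β i := by
  simp [Fin.sum_univ_castSucc]

/-- Padding β with a zero in the last coordinate makes the symmetric cocycle rule `pochShift_add`
applicable. -/
theorem evalGrid_shiftedProd_rising {d : ℕ} (κ : Fin (d + 1) → ℝ) (β : Fin d → ℕ)
    (x : Fin (d + 1) → ℕ) :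
    evalGrid x (shiftedProd (fun i j => κ i.castSucc + 1 + j) β) =
      pochShift (fun i => κ i + x i) (Fin.snoc (α := fun _ => ℕ) β 0) := by
  simp only [pochShift, Fin.prod_univ_castSucc, Fin.snoc_castSucc, Fin.snoc_last, shiftedProd,
    evalGrid, map_prod, map_add, eval_X, eval_C, poch_eq_prod, range_zero, prod_empty, mul_one]
  exact prod_congr rfl fun i _ => prod_congr rfl fun j _ => by ring

theorem evalGrid_shiftedProd_falling {d : ℕ} (β : Fin d → ℕ) (x : Fin (d + 1) → ℕ) :
    evalGrid x (shiftedProd (fun _ j => -(j : ℝ)) β) =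
      ∏ i, ((x i).descFactorial ((Fin.snoc (α := fun _ => ℕ) β 0 : Fin (d + 1) → ℕ) i) : ℝ) := by
  simp only [Fin.prod_univ_castSucc, Fin.snoc_castSucc, Fin.snoc_last, shiftedProd,
    evalGrid, map_prod, map_add, eval_X, eval_C, Nat.descFactorial_zero, Nat.cast_one, mul_one]
  refine prod_congr rfl fun i _ => ?_
  rw [← neg_one_pow_mul_poch_neg, poch_eq_prod, ← card_range (β i), ← prod_const,
    card_range, ← prod_mul_distrib]
  exact prod_congr rfl fun j _ => by ring

theorem hahnLam_add {d m : ℕ} (κ : Fin (d + 1) → ℝ) {α : Fin (d + 1) → ℕ}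
    (hα : ∑ i, α i = m) : hahnLam (fun i => κ i + α i) = hahnLam κ + m := by
  simp only [hahnLam, sum_add_distrib, ← hα, Nat.cast_sum]
  ring

/-- Splitting (κ+α+1)_{y+β} in both orders gives (κ+α+1)_y (κ+α+y+1)_β = (κ+α+1)_β (κ+α+β+1)_y. The
first factor leaves the sum, and what remains is the total Hahn mass for κ+α+β. -/
theorem urnAverage_rising {d m M : ℕ} (κ : Fin (d + 1) → ℝ) (β : Fin d → ℕ)
    {α : Fin (d + 1) → ℕ} (hα : α ∈ homGrid d m) :
    urnAverage κ M (fun x => evalGrid x (shiftedProd (fun i j => κ i.castSucc + 1 + j) β)) α =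
      poch (hahnLam κ + m + (∑ i, β i : ℕ)) M / (M.factorial : ℝ) *
        evalGrid α (shiftedProd (fun i j => κ i.castSucc + 1 + j) β) := by
  simp only [evalGrid_shiftedProd_rising]
  have hb := sum_snoc_zero β
  set b : Fin (d + 1) → ℕ := Fin.snoc (α := fun _ => ℕ) β 0
  rw [urnAverage_apply, ← hahnLam_add κ (mem_homGrid.1 hα), ← hahnLam_add _ hb,
    ← sum_hahnWeight, sum_mul]
  refine sum_congr rfl fun y _ => ?_
  have h1 := pochShift_add (fun i => κ i + α i) y b
  rw [add_comm y b, pochShift_add] at h1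
  have h2 : (fun i => κ i + ((α + y) i : ℝ)) = fun i => κ i + (α i : ℝ) + (y i : ℝ) := by
    ext i
    simp [add_assoc]
  simp only [hahnWeight]
  rw [mul_div_assoc', div_mul_eq_mul_div]
  congr 1
  rw [mul_comm _ (pochShift _ b), h1, mul_comm]
  congr 2

/-- With α = b + y, the falling factorial of α of order b times binom(x, α) equals the falling
factorial of x of order b times binom(x - b, y); Vandermonde then sums over y. -/
theorem samplingSum_falling {d m N : ℕ} (β : Fin d → ℕ) (hβ : ∑ i, β i ≤ m)
    {x : Fin (d + 1) → ℕ} (hx : x ∈ homGrid d N) :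
    samplingSum d m (fun α => evalGrid α (shiftedProd (fun _ j => -(j : ℝ)) β)) x =
      ((N - ∑ i, β i).choose (m - ∑ i, β i) : ℝ) *
        evalGrid x (shiftedProd (fun _ j => -(j : ℝ)) β) := by
  simp only [samplingSum_apply, evalGrid_shiftedProd_falling, ← prod_mul_distrib]
  have hb := sum_snoc_zero β
  set b : Fin (d + 1) → ℕ := Fin.snoc (α := fun _ => ℕ) β 0
  rw [sum_homGrid_add hb (Nat.add_sub_cancel' hβ)]
  · have key : ∀ y, ∏ i, ((((b + y) i).descFactorial (b i) : ℝ) * ((x i).choose ((b + y) i) : ℝ)) =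
        (∏ i, ((x i).descFactorial (b i) : ℝ)) * ∏ i, (((x - b) i).choose (y i) : ℝ) := by
      intro y
      rw [← prod_mul_distrib]
      refine prod_congr rfl fun i _ => ?_
      rw [← Nat.cast_mul, ← Nat.cast_mul, Nat.cast_inj]
      simp only [Pi.add_apply, Pi.sub_apply, Nat.descFactorial_eq_factorial_mul_choose]
      have h := Nat.choose_mul (n := x i) (Nat.le_add_right (b i) (y i))
      rw [Nat.add_sub_cancel_left] at h
      linear_combination (b i).factorial * h
    simp only [key, ← mul_sum, sum_prod_natChoose]
    rw [mul_comm]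
    -- The subtraction x - b is truncated; where it is not genuine, the falling factorial of x
    -- vanishes on both sides.
    by_cases hle : b ≤ x
    · congr 3
      rw [← hb, ← mem_homGrid.1 hx]
      refine Nat.eq_sub_of_add_eq ?_
      rw [← sum_add_distrib]
      exact sum_congr rfl fun i _ => Nat.sub_add_cancel (hle i)
    · obtain ⟨i, hi⟩ := not_forall.1 hle
      rw [prod_eq_zero (mem_univ i) (by
        rw [Nat.descFactorial_of_lt (not_le.1 hi), Nat.cast_zero])]
      simp
  · intro y hy
    obtain ⟨i, hi⟩ := not_forall.1 hy
    refine prod_eq_zero (mem_univ i) ?_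
    rw [Nat.descFactorial_of_lt (not_le.1 hi)]
    simp

/-! ### Spectrum of the composite operator -/

/-- The eigenvalue of `samplingSum ∘ urnAverage` on `𝒱_n^d`. -/
noncomputable def hahnEigenvalue {d : ℕ} (κ : Fin (d + 1) → ℝ) (m N n : ℕ) : ℝ :=
  ((N - n).choose (m - n) : ℝ) *
    (poch (hahnLam κ + m + n) (N - m) / ((N - m).factorial : ℝ))

/-- The two operators are diagonal on different families of products, so the composite is only
triangular, with the product of the two eigenvalues as leading scalar. -/
theorem exists_lower_samplingSum_urnAverage {d n m N : ℕ} (κ : Fin (d + 1) → ℝ) (hnm : n ≤ m)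
    {p : MvPolynomial (Fin d) ℝ} (hp : p ∈ lowDegree d (n + 1)) :
    ∃ r ∈ lowDegree d n, ∀ x ∈ homGrid d N,
      samplingSum d m (urnAverage κ (N - m) fun y => evalGrid y p) x =
        evalGrid x (hahnEigenvalue κ m N n • p + r) := by
  obtain ⟨r, hr, h⟩ := exists_lower_of_diagonal (n := n) (M := n) (N := m) _
    (fun k => poch (hahnLam κ + m + k) (N - m) / ((N - m).factorial : ℝ)) (urnAverage κ (N - m))
    (fun β _ α hα => urnAverage_rising κ β hα) le_rfl hp
  obtain ⟨s, hs, h'⟩ := exists_lower_of_diagonal (N := N) _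
    (fun k => ((N - k).choose (m - k) : ℝ)) (samplingSum d m)
    (fun β hβ x hx => samplingSum_falling β hβ hx) hnm
    (add_mem (Submodule.smul_mem _ _ hp) (lowDegree_mono n.le_succ hr))
  refine ⟨((N - n).choose (m - n) : ℝ) • r + s, add_mem (Submodule.smul_mem _ _ hr) hs,
    fun x hx => ?_⟩
  rw [samplingSum_congr h, h' x hx, hahnEigenvalue]
  congr 1
  module

theorem exists_samplingSum_urnAverage_eq {d k m N : ℕ} (κ : Fin (d + 1) → ℝ) (hkm : k ≤ m)
    {p : MvPolynomial (Fin d) ℝ} (hp : p ∈ lowDegree d k) :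
    ∃ r ∈ lowDegree d k, ∀ x ∈ homGrid d N,
      samplingSum d m (urnAverage κ (N - m) fun y => evalGrid y p) x = evalGrid x r := by
  cases k with
  | zero =>
    obtain rfl : p = 0 := by simpa [lowDegree_zero] using hp
    exact ⟨0, zero_mem _, fun x _ => by simp [evalGrid, ← Pi.zero_def]⟩
  | succ k =>
    obtain ⟨r, hr, h⟩ := exists_lower_samplingSum_urnAverage κ (Nat.le_of_succ_le hkm) hp
    exact ⟨_, add_mem (Submodule.smul_mem _ _ hp) (lowDegree_mono k.le_succ hr), h⟩

theorem hahnForm_eq_zero_of_mem_lowDegree {d N n : ℕ} {κ : Fin (d + 1) → ℝ}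
    {f r : MvPolynomial (Fin d) ℝ} (hf : f ∈ hahnSpace κ N n) (hr : r ∈ lowDegree d n) :
    hahnForm κ N f r = 0 := by
  rcases eq_zero_or_totalDegree_lt hr with rfl | h
  · exact map_zero _
  · exact hf.2 r h

/-- Write SUf = λf + r with r of degree below n. Self-adjointness gives ⟨r, λf + r⟩ = ⟨SUr, f⟩ = 0,
because SUr again has degree below n. Since ⟨r, f⟩ = 0 too, ⟨r, r⟩ = 0 and r = 0. -/
theorem samplingSum_urnAverage_of_mem_hahnSpace {d n m N : ℕ} {κ : Fin (d + 1) → ℝ}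
    (hκ : ∀ i, -1 < κ i) (hnm : n ≤ m) (hmN : m ≤ N) {f : MvPolynomial (Fin d) ℝ}
    (hf : f ∈ hahnSpace κ N n) {x : Fin (d + 1) → ℕ} (hx : x ∈ homGrid d N) :
    samplingSum d m (urnAverage κ (N - m) fun y => evalGrid y f) x =
      hahnEigenvalue κ m N n * evalGrid x f := by
  obtain ⟨r, hr, h⟩ :=
    exists_lower_samplingSum_urnAverage κ hnm (mem_lowDegree_succ.2 hf.1)
  obtain ⟨s, hs, h'⟩ := exists_samplingSum_urnAverage_eq κ hnm hr
  suffices hr0 : r = 0 by rw [h x hx, hr0]; simp [evalGrid]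
  by_contra hne
  have hpos : 0 < hahnForm κ N r r := hahnForm_pos hκ hne <| by
    have := (eq_zero_or_totalDegree_lt hr).resolve_left hne
    omega
  have hadj : hahnForm κ N r (hahnEigenvalue κ m N n • f + r) = hahnForm κ N f s := by
    have hN : m + (N - m) = N := Nat.add_sub_cancel' hmN
    simp only [hahnForm_apply]
    congr 1
    calc _ = ∑ x ∈ homGrid d N, evalGrid x r *
          samplingSum d m (urnAverage κ (N - m) fun y => evalGrid y f) x * hahnWeight κ x :=
          sum_congr rfl fun x hx => by rw [h x hx]
      _ = ∑ x ∈ homGrid d N, evalGrid x f *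
          samplingSum d m (urnAverage κ (N - m) fun y => evalGrid y r) x * hahnWeight κ x := by
          rw [← sum_hahnWeight_mul_urnAverage κ hN, ← sum_hahnWeight_mul_urnAverage κ hN]
          exact sum_congr rfl fun α _ => by ring
      _ = _ := sum_congr rfl fun x hx => by rw [h' x hx]
  rw [map_add, map_smul, hahnForm_symm κ N r f, hahnForm_eq_zero_of_mem_lowDegree hf hr,
    hahnForm_eq_zero_of_mem_lowDegree hf hs, smul_zero, zero_add] at hadj
  exact hpos.ne' hadj

/-! ### Frame coefficients as urn averages -/

theorem evalGrid_homCoord {d N : ℕ} {x : Fin (d + 1) → ℕ} (hx : x ∈ homGrid d N)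
    (i : Fin (d + 1)) : evalGrid x (homCoord d N i) = x i := by
  induction i using Fin.lastCases with
  | last =>
    rw [← mem_homGrid.1 hx]
    simp [homCoord, evalGrid, Fin.sum_univ_castSucc]
  | cast i => simp [homCoord, evalGrid]

theorem evalGrid_hahnMonic {d N : ℕ} {x : Fin (d + 1) → ℕ} (hx : x ∈ homGrid d N)
    (α : Fin (d + 1) → ℕ) :
    evalGrid x (hahnMonic N α) = ∏ i, ((x i).descFactorial (α i) : ℝ) := by
  have h : ∀ i, evalGrid x (Polynomial.aeval (-homCoord d N i) (ascPochhammer ℝ (α i))) =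
      poch (-(x i : ℝ)) (α i) := by
    intro i
    have hi := evalGrid_homCoord hx i
    simp only [evalGrid, ← MvPolynomial.coe_aeval_eq_eval] at hi ⊢
    change MvPolynomial.aeval _ _ = _ at hi ⊢
    rw [← Polynomial.aeval_algHom_apply, map_neg, hi, Polynomial.coe_aeval_eq_eval, poch]
  have h2 : evalGrid x (hahnMonic N α) = (-1) ^ (∑ i, α i) *
      ∏ i, evalGrid x (Polynomial.aeval (-homCoord d N i) (ascPochhammer ℝ (α i))) := by
    simp [evalGrid, hahnMonic]
  rw [h2, ← prod_pow_eq_pow_sum, ← prod_mul_distrib]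
  exact prod_congr rfl fun i _ => by rw [h, neg_one_pow_mul_poch_neg]

theorem pochShift_pos {d : ℕ} {κ : Fin (d + 1) → ℝ} (hκ : ∀ i, -1 < κ i)
    (α : Fin (d + 1) → ℕ) : 0 < pochShift κ α :=
  prod_pos fun i _ => poch_pos (by linarith [hκ i]) _

/-- On the grid m_α is α! times a product of binomials, supported on x ≥ α. Thus x = α + y, the
weight factors through H_κ(α), and α! H_κ(α) = (κ+1)_α. -/
theorem hahnForm_hahnMonic {d m N : ℕ} (κ : Fin (d + 1) → ℝ) (hmN : m ≤ N)
    {α : Fin (d + 1) → ℕ} (hα : α ∈ homGrid d m) (f : MvPolynomial (Fin d) ℝ) :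
    hahnForm κ N f (hahnMonic N α) = (N.factorial : ℝ) / poch (hahnLam κ) N *
      (pochShift κ α * urnAverage κ (N - m) (fun x => evalGrid x f) α) := by
  rw [hahnForm_apply, sum_congr rfl fun x hx => by rw [evalGrid_hahnMonic hx]]
  congr 1
  rw [sum_homGrid_add (mem_homGrid.1 hα) (Nat.add_sub_cancel' hmN), urnAverage_apply, mul_sum]
  · refine sum_congr rfl fun y _ => ?_
    have h := hahnWeight_mul_hahnWeight κ α y
    have h1 : ∏ i, (((α + y) i).descFactorial (α i) : ℝ) =
        (∏ i, ((α i).factorial : ℝ)) * ∏ i, (((α + y) i).choose (α i) : ℝ) := by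
      rw [← prod_mul_distrib]
      exact prod_congr rfl fun i _ => by
        rw [Nat.descFactorial_eq_factorial_mul_choose, Nat.cast_mul]
    have h2 : hahnWeight κ α * ∏ i, ((α i).factorial : ℝ) = pochShift κ α :=
      div_mul_cancel₀ _ (factorial_prod_ne_zero α)
    rw [h1, ← h2]
    linear_combination -(evalGrid (α + y) f * ∏ i, ((α i).factorial : ℝ)) * h
  · intro x hx
    obtain ⟨i, hi⟩ := not_forall.1 hx
    rw [prod_eq_zero (mem_univ i)]
    · simp
    · rw [Nat.descFactorial_of_lt (not_le.1 hi), Nat.cast_zero]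

theorem hahnQ_mem {d n N : ℕ} {κ : Fin (d + 1) → ℝ} (hκ : ∀ i, -1 < κ i) (hn : n ≤ N)
    (α : Fin (d + 1) → ℕ) : hahnQ hκ hn α ∈ hahnSpace κ N n :=
  Submodule.smul_mem _ _ (Submodule.projection_apply_mem _ _)

theorem hahnForm_hahnProj {d n N : ℕ} {κ : Fin (d + 1) → ℝ} (hκ : ∀ i, -1 < κ i) (hn : n ≤ N)
    {f : MvPolynomial (Fin d) ℝ} (hf : f ∈ hahnSpace κ N n) (p : MvPolynomial (Fin d) ℝ) :
    hahnForm κ N f (hahnProj hκ hn p) = hahnForm κ N f p := by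
  have h : hahnForm κ N f (p - hahnProj hκ hn p) = 0 :=
    Submodule.sub_projection_mem (isCompl_hahnSpace hκ hn) p f hf
  rw [map_sub, sub_eq_zero] at h
  exact h.symm

/-- Pairing with f in 𝒱_n does not see the projection, and the normalisation of Q_α cancels (κ+1)_α.
-/
theorem hahnForm_hahnQ {d n m N : ℕ} {κ : Fin (d + 1) → ℝ} (hκ : ∀ i, -1 < κ i) (hn : n ≤ N)
    (hmN : m ≤ N) {f : MvPolynomial (Fin d) ℝ} (hf : f ∈ hahnSpace κ N n)
    {α : Fin (d + 1) → ℕ} (hα : α ∈ homGrid d m) :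
    hahnForm κ N f (hahnQ hκ hn α) = (N.factorial : ℝ) / poch (hahnLam κ) N *
      urnAverage κ (N - m) (fun x => evalGrid x f) α := by
  rw [hahnQ, map_smul, hahnForm_hahnProj hκ hn hf, hahnForm_hahnMonic κ hmN hα, smul_eq_mul]
  have := (pochShift_pos hκ α).ne'
  field_simp

/-- Adjointness moves one urn average across, leaving SU acting on g as a scalar. Of the two factors
c, one is absorbed into the form. -/
theorem sum_hahnForm_hahnQ_mul {d n m N : ℕ} {κ : Fin (d + 1) → ℝ} (hκ : ∀ i, -1 < κ i)
    (hnm : n ≤ m) (hmN : m ≤ N) {f g : MvPolynomial (Fin d) ℝ} (hf : f ∈ hahnSpace κ N n)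
    (hg : g ∈ hahnSpace κ N n) :
    ∑ α ∈ homGrid d m, hahnWeight κ α * (hahnForm κ N f (hahnQ hκ (hnm.trans hmN) α) *
        hahnForm κ N g (hahnQ hκ (hnm.trans hmN) α)) =
      (N.factorial : ℝ) / poch (hahnLam κ) N * hahnEigenvalue κ m N n * hahnForm κ N f g := by
  have h := sum_hahnWeight_mul_urnAverage κ (Nat.add_sub_cancel' hmN)
    (fun x => evalGrid x f) (urnAverage κ (N - m) fun x => evalGrid x g)
  rw [hahnForm_apply]
  set c := (N.factorial : ℝ) / poch (hahnLam κ) N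
  have h1 : ∑ x ∈ homGrid d N, evalGrid x f *
      samplingSum d m (urnAverage κ (N - m) fun y => evalGrid y g) x * hahnWeight κ x =
      hahnEigenvalue κ m N n * ∑ x ∈ homGrid d N, evalGrid x f * evalGrid x g * hahnWeight κ x := by
    rw [mul_sum]
    refine sum_congr rfl fun x hx => ?_
    rw [samplingSum_urnAverage_of_mem_hahnSpace hκ hnm hmN hg hx]
    ring
  rw [h1] at h
  calc _ = c * c * ∑ α ∈ homGrid d m, hahnWeight κ α *
        (urnAverage κ (N - m) (fun x => evalGrid x g) α *
          urnAverage κ (N - m) (fun x => evalGrid x f) α) := by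
        rw [mul_sum]
        refine sum_congr rfl fun α hα => ?_
        rw [hahnForm_hahnQ hκ _ hmN hf hα, hahnForm_hahnQ hκ _ hmN hg hα]
        ring
    _ = _ := by rw [h]; ring

/-! ### The frame constant -/

theorem hahnD_mul_hahnEigenvalue {d n m N : ℕ} {κ : Fin (d + 1) → ℝ} (hκ : ∀ i, -1 < κ i)
    (hnm : n ≤ m) (hmN : m ≤ N) :
    hahnD κ n m N * ((N.factorial : ℝ) / poch (hahnLam κ) N * hahnEigenvalue κ m N n) = 1 := by
  -- With m = n + a and N = n + a + b the truncated subtractions become a, b and a + b.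
  obtain ⟨a, rfl⟩ := Nat.exists_eq_add_of_le hnm
  obtain ⟨b, rfl⟩ := Nat.exists_eq_add_of_le hmN
  have hl := hahnLam_pos hκ
  have e1 : n + a + b - (n + a) = b := by omega
  have e2 : n + a + b - n = a + b := by omega
  have e3 : n + a - n = a := by omega
  have h1 : (a.factorial : ℝ) * (n + a).descFactorial n = (n + a).factorial := by
    have := Nat.factorial_mul_descFactorial hnm
    rw [e3] at this
    exact_mod_cast this
  have h2 : ((a + b).factorial : ℝ) * (n + a + b).descFactorial n = (n + a + b).factorial := by
    have := Nat.factorial_mul_descFactorial (hnm.trans hmN)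
    rw [e2] at this
    exact_mod_cast this
  have h3 : (b.factorial : ℝ) * (n + a + b).descFactorial (n + a) = (n + a + b).factorial := by
    have := Nat.factorial_mul_descFactorial hmN
    rw [e1] at this
    exact_mod_cast this
  have h4 : ((a + b).choose a : ℝ) * a.factorial * b.factorial = (a + b).factorial := by
    rw [add_comm a b, mul_right_comm]
    exact_mod_cast Nat.add_choose_mul_factorial_mul_factorial b a
  -- The Pochhammer factor of the eigenvalue is the quotient (λ_κ)_{N+n} / (λ_κ)_{m+n}.
  have h5 : poch (hahnLam κ) (n + a + b + n) = poch (hahnLam κ) (n + a + n) *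
      poch (hahnLam κ + (n + a : ℕ) + n) b := by
    rw [add_right_comm, poch_add]
    push_cast
    rw [← add_assoc]
  have p1 := poch_pos hl (n + a + b)
  have p2 := poch_pos hl (n + a + n)
  have p3 : 0 < poch (hahnLam κ + (n + a : ℕ) + n) b := poch_pos (by positivity) b
  have q1 : (0 : ℝ) < (n + a).descFactorial n := by
    exact_mod_cast Nat.descFactorial_pos.2 hnm
  have q2 : (0 : ℝ) < (n + a + b).descFactorial n := by
    exact_mod_cast Nat.descFactorial_pos.2 (hnm.trans hmN)
  have q3 : (0 : ℝ) < (n + a + b).descFactorial (n + a) := by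
    exact_mod_cast Nat.descFactorial_pos.2 hmN
  rw [hahnD, hahnEigenvalue, e1, e2, e3, h5, poch_neg, poch_neg, poch_neg, mul_pow, ← pow_mul,
    mul_comm (n + a) 2, pow_mul, neg_one_sq, one_pow, one_mul]
  have hf : (0 : ℝ) < b.factorial := by positivity
  have hs : ((-1 : ℝ) ^ n) ≠ 0 := by simp
  have ha : (0 : ℝ) < a.factorial := by positivity
  have hab : (0 : ℝ) < (a + b).factorial := by positivity
  field_simp
  rw [← h1, ← h3]
  -- `h2` and `h3` are two factorisations of N!; their difference removes the last factorials.
  linear_combination ((n + a).descFactorial n : ℝ) * (n + a + b).descFactorial (n + a) *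
    ((n + a + b).descFactorial n * h4 + h2 - h3)

/-- Positivity is read off from a product equal to 1 whose other factor is nonnegative, avoiding the
signs of (-N)_n and (-m)_n. -/
theorem hahnD_pos {d n m N : ℕ} {κ : Fin (d + 1) → ℝ} (hκ : ∀ i, -1 < κ i)
    (hnm : n ≤ m) (hmN : m ≤ N) : 0 < hahnD κ n m N := by
  refine pos_of_mul_pos_left (b := (N.factorial : ℝ) / poch (hahnLam κ) N * hahnEigenvalue κ m N n)
    ?_ ?_
  · rw [hahnD_mul_hahnEigenvalue hκ hnm hmN]
    exact one_pos
  · have hl := hahnLam_pos hκ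
    have p1 := poch_pos hl N
    have p2 : 0 < poch (hahnLam κ + m + n) (N - m) := poch_pos (by positivity) _
    rw [hahnEigenvalue]
    positivity

/-! ### Tight frame and expansion -/

theorem hahnForm_eq_hahnD_mul_sum {d n m N : ℕ} {κ : Fin (d + 1) → ℝ} (hκ : ∀ i, -1 < κ i)
    (hnm : n ≤ m) (hmN : m ≤ N) {f g : MvPolynomial (Fin d) ℝ} (hf : f ∈ hahnSpace κ N n)
    (hg : g ∈ hahnSpace κ N n) :
    hahnForm κ N f g = hahnD κ n m N * ∑ α ∈ homGrid d m, hahnWeight κ α *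
      (hahnForm κ N f (hahnQ hκ (hnm.trans hmN) α) *
        hahnForm κ N g (hahnQ hκ (hnm.trans hmN) α)) := by
  rw [sum_hahnForm_hahnQ_mul hκ hnm hmN hf hg, ← mul_assoc,
    hahnD_mul_hahnEigenvalue hκ hnm hmN, one_mul]

theorem theorem5p1 {d n m N : ℕ} (κ : Fin (d + 1) → ℝ) (hκ : ∀ i, -1 < κ i)
    (hnm : n ≤ m) (hmN : m ≤ N) :
    (∀ f ∈ hahnSpace κ N n,
      f = hahnD κ n m N • ∑ α ∈ homGrid d m,
        (hahnWeight κ α * hahnForm κ N f (hahnQ hκ (hnm.trans hmN) α)) •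
          hahnQ hκ (hnm.trans hmN) α) ∧
    (∀ α ∈ homGrid d m, hahnQ hκ (hnm.trans hmN) α ∈ hahnSpace κ N n) ∧
    (∀ f ∈ hahnSpace κ N n,
      hahnForm κ N f f = hahnD κ n m N * ∑ α ∈ homGrid d m,
        hahnWeight κ α * (hahnForm κ N f (hahnQ hκ (hnm.trans hmN) α)) ^ 2) ∧
    IsTightFrame (hahnForm κ N) (hahnSpace κ N n) (homGrid d m)
      (fun α => Real.sqrt (hahnD κ n m N * hahnWeight κ α) • hahnQ hκ (hnm.trans hmN) α) := by
  have hQ := hahnQ_mem hκ (hnm.trans hmN)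
  have hnorm : ∀ f ∈ hahnSpace κ N n,
      hahnForm κ N f f = hahnD κ n m N * ∑ α ∈ homGrid d m,
        hahnWeight κ α * (hahnForm κ N f (hahnQ hκ (hnm.trans hmN) α)) ^ 2 := by
    intro f hf
    simpa only [sq] using hahnForm_eq_hahnD_mul_sum hκ hnm hmN hf hf
  refine ⟨fun f hf => ?_, fun α _ => hQ α, hnorm, fun α _ => Submodule.smul_mem _ _ (hQ α),
    fun f hf => ?_⟩
  · set T := hahnD κ n m N • ∑ α ∈ homGrid d m,
      (hahnWeight κ α * hahnForm κ N f (hahnQ hκ (hnm.trans hmN) α)) •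
        hahnQ hκ (hnm.trans hmN) α with hT
    have hTmem : T ∈ hahnSpace κ N n := Submodule.smul_mem _ _
      (Submodule.sum_mem _ fun α _ => Submodule.smul_mem _ _ (hQ α))
    -- By the polarised identity `f - T` is orthogonal to 𝒱_n; it also lies in 𝒱_n, where the form
    -- is positive definite.
    have horth : ∀ g ∈ hahnSpace κ N n, hahnForm κ N g (f - T) = 0 := by
      intro g hg
      rw [map_sub, sub_eq_zero, hahnForm_symm, hahnForm_eq_hahnD_mul_sum hκ hnm hmN hf hg, hT,
        map_smul, map_sum, smul_eq_mul]
      congr 1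
      refine sum_congr rfl fun α _ => ?_
      rw [map_smul, smul_eq_mul, mul_assoc]
    by_contra hne
    have hmem := sub_mem hf hTmem
    exact (hahnForm_pos hκ (sub_ne_zero.2 hne) (hmem.1.trans (hnm.trans hmN))).ne'
      (horth _ hmem)
  · rw [hnorm f hf, mul_sum]
    refine sum_congr rfl fun α _ => ?_
    rw [map_smul, smul_eq_mul, mul_pow, Real.sq_sqrt, mul_assoc]
    exact mul_nonneg (hahnD_pos hκ hnm hmN).le (hahnWeight_pos hκ α).le
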